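/- **Setting.** Each link $I_k$ ($k=1,2,3$) of a junction $J$ carries a continuous fundamental diagram $f_k:[0,\rho_k^{jam}]\to[0,C_k]$ with $f_k(0)=f_k(\rho^{jam}_k)=0$, strictly increasing on $[0,\rho_k^*]$ (free flow) and strictly decreasing on $[\rho_k^*,\rho_k^{jam}]$ (congestion), where $0<\rho_k^*<\rho_k^{jam}$ and $C_k=f_k(\rho_k^*)$. At density $\rho$ the demand of an incoming link is $D_k=f_k(\rho)$ if $\rho\le\rho_k^*$ and $C_k$ otherwise; the supply of an outgoing link is $S_k=C_k$ if $\rho\le\rho_k^*$ and $f_k(\rho)$ otherwise. *Diverge* (incoming link 1, outgoing links 2, 3; constant turning rates $\alpha_{1,2},\alpha_{1,3}>0$, $\alpha_{1,2}+\alpha_{1,3}=1$): the flows through $J$ are $q_1=\min\{D_1,S_2/\alpha_{1,2},S_3/\alpha_{1,3}\}$, $q_2=\alpha_{1,2}q_1$, $q_3=\alpha_{1,3}q_1$. *Merge* (incoming links 1, 2, outgoing link 3; right-of-way parameter $p\in(0,1)$): $(q_1,q_2)$ maximizes $q_1+q_2$ subject to $0\le q_1\le D_1$, $0\le q_2\le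 D_2$, $q_1+q_2\le S_3$, and among all maximizers it is the one closest to the line $q_2=p\,q_1$; $q_3=q_1+q_2$. The Riemann solver assigns to the densities $(\rho_k)$ at $J$ new densities $(\hat\rho_k)$ with $f_k(\hat\rho_k)=q_k$: $\hat\rho_k=\rho_k$ if $f_k(\rho_k)=q_k$, and otherwise $\hat\rho_k$ is congested (or critical) on an incoming link and free (or critical) on an outgoing link. *Interaction.* The junction is at rest in a state fixed by the Riemann solver; a front on a link $I_i$, between the density $\rho_i^-$ at $J$ and a density $\rho_i^+$ behind it, moving towards $J$ with its Rankine–Hugoniot speed, hits $J$ (fronts are shocks, or rarefaction fronts whose two states lie in the same phase). The Riemann problem with $\rho_i^-$ replaced by $\rho_i^+$ is solved, and on each link $I_j$ a wave (possibly trivial) is produced, from the density on $I_j$ in these Riemann data to the new density. Let $\Delta\rho_i,\Delta q_i$ be the jumps of density and flux across the arriving front and $\Delta\rho_j,\Delta q_j$ those across the wave produced on $I_j$ (for $j=i$: across the wave reflected into $I_i$). If the arriving front is shifted in space by $\xi_i$, the interaction time changes by $-\xi_i/s_i$, with $s_i=\Delta q_i/\Delta\rho_i$, and so the front produced on $I_j$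 is shifted by $\xi_j=s_j\xi_i/s_i$, with $s_j=\Delta q_j/\Delta\rho_j$. The corresponding tangent-vector norms are $|\xi_i\Delta\rho_i|$ and $|\xi_j\Delta\rho_j|$. **Proposition.** (a) For merge and diverge junctions, in every interaction $$\xi_j\Delta\rho_j=\frac{\Delta q_j}{\Delta q_i}\,\xi_i\Delta\rho_i,\qquad |\xi_j\Delta\rho_j|=\frac{|\Delta q_j|}{|\Delta q_i|}\,|\xi_i\Delta\rho_i| .$$ (b) For a diverge junction put $$(\gamma_{ij})=\begin{pmatrix}1&\alpha_{1,2}&\alpha_{1,3}\\ 1/\alpha_{1,2}&1&\alpha_{1,3}/\alpha_{1,2}\\ 1/\alpha_{1,3}&\alpha_{1,2}/\alpha_{1,3}&1\end{pmatrix}.$$ Then $\gamma_{ij}\gamma_{jk}=\gamma_{ik}$ for all $i,j,k$, and for $j\neq i$ one has $|\Delta q_j|/|\Delta q_i|\le\gamma_{ij}$, with equality if the interaction produces no wave on $I_i$. (c) For merge and diverge junctions the multiplication factors are uniformly bounded, regardless of the number of interactions: there is a constant $C$, depending only on $(\alpha_{1,2},\alpha_{1,3})$, respectively on $p$, such that for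 all fundamental diagrams, every $N\ge1$ and every chain of $N$ interactions with $J$ in which the wave produced on link $I_{i_k}$ by the $k$-th interaction returns to $J$ on that link as the arriving wave of the $(k+1)$-st (the states of $J$ and the strengths of the waves being otherwise arbitrary), $$\prod_{k=1}^{N}\frac{|\Delta q_{i_k}^{(k)}|}{|\Delta q_{i_{k-1}}^{(k)}|}\le C,$$ where in the $k$-th interaction the wave arrives on $I_{i_{k-1}}$ and the wave followed is the one produced on $I_{i_k}$. Consequently, if the norm of the tangent vector carried by the wave does not increase on the links between two interactions with $J$, then after the $N$ interactions it is at most $C$ times its value before the first one. -/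

import Mathlib

noncomputable section

namespace TrafficJunction

/-- A fundamental diagram: the flow `f` as a function of the density in `[0, ρjam]`, strictly
increasing in the free flow phase `[0, ρcrit]` and strictly decreasing in the congested phase
`[ρcrit, ρjam]`, so that each flow below capacity is attained by exactly one density of each phase.
The triangular fundamental diagram is of this kind. -/
structure FundamentalDiagram where
  f : ℝ → ℝ
  ρcrit : ℝ
  ρjam : ℝ
  crit_pos : 0 < ρcrit
  crit_lt_jam : ρcrit < ρjam
  f_zero : f 0 = 0
  f_jam : f ρjam = 0
  continuousOn_f : ContinuousOn f (Set.Icc 0 ρjam)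
  strictMonoOn_f : StrictMonoOn f (Set.Icc 0 ρcrit)
  strictAntiOn_f : StrictAntiOn f (Set.Icc ρcrit ρjam)

namespace FundamentalDiagram

variable (F : FundamentalDiagram)

/-- The flow capacity `C`. -/
def capacity : ℝ := F.f F.ρcrit

/-- The regime is `r = 1` (congested) for `ρ > ρcrit` and `r = 0` (free flow) otherwise. -/
def Congested (ρ : ℝ) : Prop := F.ρcrit < ρ

open Classical in
/-- The demand of an incoming link whose density at the junction is `ρ`. -/
def demand (ρ : ℝ) : ℝ := if F.Congested ρ then F.capacity else F.f ρ

open Classical in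
/-- The supply of an outgoing link whose density at the junction is `ρ`. -/
def supply (ρ : ℝ) : ℝ := if F.Congested ρ then F.f ρ else F.capacity

/-- Rankine-Hugoniot speed of a front between the densities `ρ` and `ρ'`
(symmetric in its two arguments). -/
def speed (ρ ρ' : ℝ) : ℝ := (F.f ρ' - F.f ρ) / (ρ' - ρ)

/-- The fronts of a wave-front tracking approximation, with left state `l` and right state `r`:
shocks (`l < r`), and rarefaction fronts (`r < l`). A rarefaction fan through the critical density
is always split at the critical density, so the two states of a rarefaction front belong to the
same phase. -/
def IsFront (l r : ℝ) : Prop :=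
  l ∈ Set.Icc 0 F.ρjam ∧ r ∈ Set.Icc 0 F.ρjam ∧
    (l < r ∨ (r < l ∧ (l ≤ F.ρcrit ∨ F.ρcrit ≤ r)))

end FundamentalDiagram

/-- A link at a junction is incoming (the junction is its exit `b`) or outgoing (the junction is
its entrance `a`). -/
inductive Side
  | incoming
  | outgoing

/-- A junction of three links: `rule m q` says that `q` are the flows through the junction
(out of the incoming links, into the outgoing ones), given the demands `m k` of the incoming links
`k` and the supplies `m k` of the outgoing links `k`. Only the two junctions `diverge` and `merge`
below are considered. -/
structure Junction where
  link : Fin 3 → FundamentalDiagram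
  side : Fin 3 → Side
  rule : (Fin 3 → ℝ) → (Fin 3 → ℝ) → Prop

/-- The first-in-first-out diverge rule with incoming link `0`, outgoing links `1` and `2` and
turning rates `α₁`, `α₂` towards them. -/
def IsDivergeFlux (α₁ α₂ : ℝ) (m q : Fin 3 → ℝ) : Prop :=
  q 0 = min (m 0) (min (m 1 / α₁) (m 2 / α₂)) ∧ q 1 = α₁ * q 0 ∧ q 2 = α₂ * q 0

/-- The pairs of flows out of the incoming links `0` and `1` of a merge that respect the demands
`m 0`, `m 1` and the supply `m 2` of the outgoing link. -/
def MergeFeasible (m : Fin 3 → ℝ) (x y : ℝ) : Prop :=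
  0 ≤ x ∧ x ≤ m 0 ∧ 0 ≤ y ∧ y ≤ m 1 ∧ x + y ≤ m 2

/-- The merge rule with right-of-way parameter `p`, incoming links `0`, `1`, outgoing link `2`:
the flow through the junction is maximal, and among the points of maximal flow the chosen one is
closest to the line `p x = y` (the distance of `(x, y)` from it is `|p x - y| / √(1 + p²)`). -/
def IsMergeFlux (p : ℝ) (m q : Fin 3 → ℝ) : Prop :=
  MergeFeasible m (q 0) (q 1) ∧ q 2 = q 0 + q 1 ∧
    (∀ x y, MergeFeasible m x y → x + y ≤ q 0 + q 1) ∧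
    (∀ x y, MergeFeasible m x y → x + y = q 0 + q 1 → |p * q 0 - q 1| ≤ |p * x - y|)

/-- The diverge junction. -/
def diverge (α₁ α₂ : ℝ) (link : Fin 3 → FundamentalDiagram) : Junction where
  link := link
  side := ![Side.incoming, Side.outgoing, Side.outgoing]
  rule := IsDivergeFlux α₁ α₂

/-- The merge junction. -/
def merge (p : ℝ) (link : Fin 3 → FundamentalDiagram) : Junction where
  link := link
  side := ![Side.incoming, Side.incoming, Side.outgoing]
  rule := IsMergeFlux p

namespace Junction

variable (J : Junction)

/-- The demand (incoming link) or supply (outgoing link) of link `k` in the state `ρ`. -/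
def bound (ρ : Fin 3 → ℝ) (k : Fin 3) : ℝ :=
  match J.side k with
  | Side.incoming => (J.link k).demand (ρ k)
  | Side.outgoing => (J.link k).supply (ρ k)

/-- The densities on link `k` that can be created at the junction: in the congested phase on an
incoming link, in the free flow phase on an outgoing link (the critical density counts as both). -/
def Reachable (k : Fin 3) (σ : ℝ) : Prop :=
  match J.side k with
  | Side.incoming => (J.link k).ρcrit ≤ σ
  | Side.outgoing => σ ≤ (J.link k).ρcrit

/-- `σ` are the densities at the junction that the Riemann solver assigns to the Riemann data `ρ`:
their flows obey the junction rule for the demands and supplies of `ρ`; where the flow of `ρ k` is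
already the right one nothing changes, and elsewhere the new density is such that the
wave between `ρ k` and `σ k` leaves the junction. -/
def IsRiemannSolution (ρ σ : Fin 3 → ℝ) : Prop :=
  (∀ k, ρ k ∈ Set.Icc 0 (J.link k).ρjam) ∧ (∀ k, σ k ∈ Set.Icc 0 (J.link k).ρjam) ∧
    J.rule (J.bound ρ) (fun k => (J.link k).f (σ k)) ∧
    ∀ k, σ k = ρ k ∨ ((J.link k).f (σ k) ≠ (J.link k).f (ρ k) ∧ J.Reachable k (σ k))

/-- A front on link `i` that has the density `ρ` on the side of the junction and `ρ'` on the side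
away from it, and that moves towards the junction. -/
def Approaching (i : Fin 3) (ρ ρ' : ℝ) : Prop :=
  match J.side i with
  | Side.incoming => (J.link i).IsFront ρ' ρ ∧ 0 < (J.link i).speed ρ ρ'
  | Side.outgoing => (J.link i).IsFront ρ ρ' ∧ (J.link i).speed ρ ρ' < 0

/-- An interaction of a wave with the junction: the junction is at rest in the state `before` (the
solution of its own Riemann problem), then a front on the link `road` with density `arriving`
behind it hits the junction, and the new Riemann problem is solved by the state `after`. -/
structure Interaction where
  before : Fin 3 → ℝ
  road : Fin 3
  arriving : ℝ
  after : Fin 3 → ℝ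
  before_rest : J.IsRiemannSolution before before
  approaching : J.Approaching road (before road) arriving
  after_solves : J.IsRiemannSolution (Function.update before road arriving) after

namespace Interaction

variable {J} (I : J.Interaction)

/-- The Riemann data at the moment of the interaction. -/
def data : Fin 3 → ℝ := Function.update I.before I.road I.arriving

/-- Density jump of the arriving wave. -/
def Δρ_in : ℝ := I.arriving - I.before I.road

/-- Flux jump of the arriving wave. -/
def Δq_in : ℝ := (J.link I.road).f I.arriving - (J.link I.road).f (I.before I.road)

/-- Density jump of the wave produced on link `j` (zero if none is produced). For `j = I.road` this
is the wave sent back on the link of the arriving wave. -/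
def Δρ_out (j : Fin 3) : ℝ := I.after j - I.data j

/-- Flux jump of the wave produced on link `j`. -/
def Δq_out (j : Fin 3) : ℝ := (J.link j).f (I.after j) - (J.link j).f (I.data j)

/-- No wave is produced on the link of the arriving wave. -/
def NoReflection : Prop := I.after I.road = I.arriving

/-- The change of the interaction time if the arriving front is shifted in space by `ξ`. -/
def timeShift (ξ : ℝ) : ℝ := -ξ / (J.link I.road).speed (I.before I.road) I.arriving

/-- The spatial shift of the front produced on link `j`, if the arriving front is shifted by `ξ`: a
front of speed `s` that starts at the junction later by `τ` is shifted by `-s τ`. -/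
def shift_out (ξ : ℝ) (j : Fin 3) : ℝ :=
  -((J.link j).speed (I.data j) (I.after j) * I.timeShift ξ)

/-- Norm of the tangent vector given by the shift `ξ` of the arriving front. -/
def norm_in (ξ : ℝ) : ℝ := |ξ * I.Δρ_in|

/-- Norm of the tangent vector given by the resulting shift of the front produced on `j`. -/
def norm_out (ξ : ℝ) (j : Fin 3) : ℝ := |I.shift_out ξ j * I.Δρ_out j|

/-- The multiplication factor from the arriving wave to the wave produced on link `j`. -/
def factor (j : Fin 3) : ℝ := |I.Δq_out j| / |I.Δq_in|

end Interaction

/-- A chain of `n + 1` interactions with the junction: the wave produced on the link `out k` in the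
`k`-th interaction comes back to the junction on this link for the next one. In between, it may
have met other waves on the link, and other waves may have changed the state of the junction, so
the states in different interactions are not related. -/
structure InteractionChain (n : ℕ) where
  step : Fin (n + 1) → J.Interaction
  out : Fin (n + 1) → Fin 3
  returns : ∀ k : Fin n, (step k.succ).road = out k.castSucc

namespace InteractionChain

variable {J} {n : ℕ} (c : J.InteractionChain n)

/-- The accumulated multiplication factor. -/
def factor : ℝ := ∏ k, (c.step k).factor (c.out k)

/-- `ξ k` is the shift of the front arriving in the `k`-th interaction; the norm of the tangent
vector does not increase while the wave is on a link, between two interactions with the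
junction. -/
def Carries (ξ : Fin (n + 1) → ℝ) : Prop :=
  ∀ k : Fin n, (c.step k.succ).norm_in (ξ k.succ) ≤
    (c.step k.castSucc).norm_out (ξ k.castSucc) (c.out k.castSucc)

end InteractionChain

/-- The shifts produced in an interaction transform tangent vectors by the ratio of the flux
jumps. -/
def ShiftFormula : Prop :=
  ∀ (I : J.Interaction) (ξ : ℝ) (j : Fin 3),
    I.shift_out ξ j * I.Δρ_out j = I.Δq_out j / I.Δq_in * (ξ * I.Δρ_in) ∧
    I.norm_out ξ j = I.factor j * I.norm_in ξ

/-- Over any number of interactions with the junction, the accumulated multiplication factor is at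
most `C`, and the norm of a tangent vector is multiplied by at most `C`. -/
def TangentBound (C : ℝ) : Prop :=
  ∀ (n : ℕ) (c : J.InteractionChain n),
    c.factor ≤ C ∧
    ∀ ξ : Fin (n + 1) → ℝ, c.Carries ξ →
      (c.step (Fin.last n)).norm_out (ξ (Fin.last n)) (c.out (Fin.last n)) ≤
        C * (c.step 0).norm_in (ξ 0)

end Junction

/-- The table of multiplication factors of a diverge junction. -/
def γ (α₁ α₂ : ℝ) : Matrix (Fin 3) (Fin 3) ℝ :=
  !![1, α₁, α₂;
     1 / α₁, 1, α₂ / α₁;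
     1 / α₂, α₁ / α₂, 1]

end TrafficJunction

end

/-! The shift formula is a cancellation: speed times density jump is flux jump on both links. It
remains to compare flux jumps.

An arriving front changes one bound of the junction rule, to the arriving flux (`bound_road`). If
the flux rises, the old bound was active; if it falls, lowering the old bound to the old flow would
not have changed the solution. So in effect the bound moves from the old flow to the arriving flux.

At a diverge the new flow on that link lies between these two values: one part of the jump is
transmitted, the rest reflected. All flows are fixed multiples of the incoming one, so `γ i j` is a
quotient `w j / w i` with `w = (1, α₁, α₂)`, and products along a chain telescope. At a merge no
produced flux jump exceeds the arriving one, so every factor is at most `1`.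
`tangentBound_of_factor_le` covers both cases through a submultiplicative table. -/

namespace TrafficJunction

/-! ### Phases of fronts that move towards the junction -/

namespace FundamentalDiagram

variable (F : FundamentalDiagram)

/-- A front that moves to the right has a free flow state on its left. If the flow increases
behind it, the state on its right is a free flow state, too. -/
theorem free_of_speed_pos {ρ ρ' : ℝ} (hF : F.IsFront ρ' ρ) (hs : 0 < F.speed ρ ρ') :
    F.demand ρ' = F.f ρ' ∧
      (F.f ρ' < F.f ρ ∨ (F.f ρ < F.f ρ' ∧ F.demand ρ = F.f ρ)) := by
  obtain ⟨⟨hl0, hlj⟩, ⟨hr0, hrj⟩, h | ⟨h, h'⟩⟩ := hF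
  · have hf : F.f ρ' < F.f ρ := by
      rcases div_pos_iff.1 hs with h1 | h1 <;> linarith [h1.1, h1.2]
    have hfree : ¬ F.Congested ρ' := fun hc => by
      have := F.strictAntiOn_f ⟨hc.le, hlj⟩ ⟨hc.le.trans h.le, hrj⟩ h
      linarith
    exact ⟨by simp [demand, hfree], Or.inl hf⟩
  · have hf : F.f ρ < F.f ρ' := by
      rcases div_pos_iff.1 hs with h1 | h1 <;> linarith [h1.1, h1.2]
    have hle : ρ' ≤ F.ρcrit := h'.resolve_right fun hc => by
      have := F.strictAntiOn_f ⟨hc, hrj⟩ ⟨hc.trans h.le, hlj⟩ h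
      linarith
    have h1 : ¬ F.Congested ρ' := not_lt.2 hle
    have h2 : ¬ F.Congested ρ := not_lt.2 (h.le.trans hle)
    exact ⟨by simp [demand, h1], Or.inr ⟨hf, by simp [demand, h2]⟩⟩

/-- A front that moves to the left has a congested state on its right. If the flow increases
behind it, the state on its left is congested, too. -/
theorem congested_of_speed_neg {ρ ρ' : ℝ} (hF : F.IsFront ρ ρ') (hs : F.speed ρ ρ' < 0) :
    F.supply ρ' = F.f ρ' ∧
      (F.f ρ' < F.f ρ ∨ (F.f ρ < F.f ρ' ∧ F.supply ρ = F.f ρ)) := by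
  obtain ⟨⟨hl0, hlj⟩, ⟨hr0, hrj⟩, h | ⟨h, h'⟩⟩ := hF
  · have hf : F.f ρ' < F.f ρ := by
      rcases div_neg_iff.1 hs with h1 | h1 <;> linarith [h1.1, h1.2]
    have hcong : F.Congested ρ' := by
      by_contra hc
      have hc := not_lt.1 hc
      have := F.strictMonoOn_f ⟨hl0, h.le.trans hc⟩ ⟨hr0, hc⟩ h
      linarith
    exact ⟨by simp [supply, hcong], Or.inl hf⟩
  · have hf : F.f ρ < F.f ρ' := by
      rcases div_neg_iff.1 hs with h1 | h1 <;> linarith [h1.1, h1.2]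
    have hle : F.ρcrit ≤ ρ' := h'.resolve_left fun hc => by
      have := F.strictMonoOn_f ⟨hr0, h.le.trans hc⟩ ⟨hl0, hc⟩ h
      linarith
    have h2 : F.Congested ρ := hle.trans_lt h
    refine ⟨?_, Or.inr ⟨hf, by simp [supply, h2]⟩⟩
    -- At the critical density the supply is the capacity, which is the flux there.
    rcases hle.lt_or_eq with h1 | h1
    · have h1 : F.Congested ρ' := h1
      simp [supply, h1]
    · simp [supply, capacity, Congested, ← h1]

end FundamentalDiagram

/-! ### Shifts and chains of interactions at a general junction -/

namespace Junction

variable {J : Junction}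

namespace Interaction

variable (I : J.Interaction)

theorem data_road : I.data I.road = I.arriving := by simp [data]

theorem data_of_ne {j : Fin 3} (hj : j ≠ I.road) : I.data j = I.before j := by simp [data, hj]

theorem bound_data_of_ne {j : Fin 3} (hj : j ≠ I.road) :
    J.bound I.data j = J.bound I.before j := by
  simp only [bound, I.data_of_ne hj]

/-- The arriving wave sets the bound on its link to the arriving flow, and either this flow is
below the flow through the junction or the old bound on the link was active. -/
theorem bound_road :
    J.bound I.data I.road = (J.link I.road).f I.arriving ∧
      ((J.link I.road).f I.arriving < (J.link I.road).f (I.before I.road) ∨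
        ((J.link I.road).f (I.before I.road) < (J.link I.road).f I.arriving ∧
          J.bound I.before I.road = (J.link I.road).f (I.before I.road))) := by
  have h := I.approaching
  unfold Approaching at h
  unfold bound
  rw [I.data_road]
  cases hs : J.side I.road <;> simp only [hs] at h ⊢
  · exact (J.link I.road).free_of_speed_pos h.1 h.2
  · exact (J.link I.road).congested_of_speed_neg h.1 h.2

theorem Δq_in_ne_zero : I.Δq_in ≠ 0 := by
  unfold Δq_in
  rcases I.bound_road.2 with h | ⟨h, -⟩
  · exact (sub_neg.2 h).ne
  · exact (sub_pos.2 h).ne'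

theorem rule_before : J.rule (J.bound I.before) fun k => (J.link k).f (I.before k) :=
  I.before_rest.2.2.1

theorem rule_after : J.rule (J.bound I.data) fun k => (J.link k).f (I.after k) :=
  I.after_solves.2.2.1

theorem factor_nonneg (j : Fin 3) : 0 ≤ I.factor j := by unfold factor; positivity

theorem norm_in_nonneg (ξ : ℝ) : 0 ≤ I.norm_in ξ := abs_nonneg _

theorem shift_out_mul (ξ : ℝ) (j : Fin 3) :
    I.shift_out ξ j * I.Δρ_out j = I.Δq_out j / I.Δq_in * (ξ * I.Δρ_in) := by
  have hj : (J.link j).speed (I.data j) (I.after j) * I.Δρ_out j = I.Δq_out j := by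
    unfold FundamentalDiagram.speed Δρ_out Δq_out
    -- For a trivial wave the speed is `0 / 0 = 0`, and both sides vanish.
    by_cases h : I.after j - I.data j = 0
    · rw [sub_eq_zero.1 h]; simp
    · exact div_mul_cancel₀ _ h
  have hi : I.timeShift ξ = -(ξ * I.Δρ_in / I.Δq_in) := by
    unfold timeShift FundamentalDiagram.speed Δρ_in Δq_in
    rw [neg_div, div_div_eq_mul_div]
  rw [shift_out, hi, ← hj]
  ring

theorem norm_out_eq (ξ : ℝ) (j : Fin 3) : I.norm_out ξ j = I.factor j * I.norm_in ξ := by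
  rw [norm_out, shift_out_mul, abs_mul, abs_div, factor, norm_in]

end Interaction

theorem shiftFormula (J : Junction) : J.ShiftFormula :=
  fun I ξ j => ⟨I.shift_out_mul ξ j, I.norm_out_eq ξ j⟩

/-- If the factors of single interactions are bounded by a table `g` with
`g i j * g j k ≤ g i k`, then so are the factors of chains. -/
theorem InteractionChain.factor_le {g : Fin 3 → Fin 3 → ℝ} (hg : ∀ i j k, g i j * g j k ≤ g i k)
    (hfac : ∀ (I : J.Interaction) j, I.factor j ≤ g I.road j) {n : ℕ}
    (c : J.InteractionChain n) : c.factor ≤ g (c.step 0).road (c.out (Fin.last n)) := by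
  induction n with
  | zero => simpa [InteractionChain.factor] using hfac (c.step 0) (c.out 0)
  | succ n ih =>
    let d : J.InteractionChain n :=
      ⟨fun k => c.step k.castSucc, fun k => c.out k.castSucc, fun k => c.returns k.castSucc⟩
    have hd : d.factor ≤ g (c.step 0).road (c.out (Fin.last n).castSucc) := ih d
    have hlast := hfac (c.step (Fin.last (n + 1))) (c.out (Fin.last (n + 1)))
    have hret : (c.step (Fin.last (n + 1))).road = c.out (Fin.last n).castSucc :=
      c.returns (Fin.last n)
    rw [hret] at hlast
    have hd0 : 0 ≤ d.factor := Finset.prod_nonneg fun k _ => (d.step k).factor_nonneg _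
    have heq : c.factor = d.factor *
        (c.step (Fin.last (n + 1))).factor (c.out (Fin.last (n + 1))) := by
      rw [InteractionChain.factor, Fin.prod_univ_castSucc]; rfl
    rw [heq]
    -- The link on which the wave returns is the middle index in `hg`.
    exact (mul_le_mul hd hlast ((c.step _).factor_nonneg _) (hd0.trans hd)).trans (hg _ _ _)

/-- Telescoping: an interaction multiplies the norm by its factor, and `Carries` bounds each
arriving norm by the norm produced before. -/
theorem InteractionChain.norm_out_le {n : ℕ} (c : J.InteractionChain n) {ξ : Fin (n + 1) → ℝ}
    (hξ : c.Carries ξ) :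
    (c.step (Fin.last n)).norm_out (ξ (Fin.last n)) (c.out (Fin.last n)) ≤
      c.factor * (c.step 0).norm_in (ξ 0) := by
  induction n with
  | zero => simp [InteractionChain.factor, Interaction.norm_out_eq]
  | succ n ih =>
    let d : J.InteractionChain n :=
      ⟨fun k => c.step k.castSucc, fun k => c.out k.castSucc, fun k => c.returns k.castSucc⟩
    have hd := ih d (ξ := fun k => ξ k.castSucc) fun k => hξ k.castSucc
    have hc := (hξ (Fin.last n)).trans hd
    have heq : c.factor = d.factor *
        (c.step (Fin.last (n + 1))).factor (c.out (Fin.last (n + 1))) := by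
      rw [InteractionChain.factor, Fin.prod_univ_castSucc]; rfl
    rw [heq, Interaction.norm_out_eq]
    calc _ ≤ (c.step (Fin.last (n + 1))).factor (c.out (Fin.last (n + 1))) *
          (d.factor * (c.step 0).norm_in (ξ 0)) :=
          mul_le_mul_of_nonneg_left hc ((c.step _).factor_nonneg _)
      _ = _ := by ring

theorem tangentBound_of_factor_le {g : Fin 3 → Fin 3 → ℝ} (hg : ∀ i j k, g i j * g j k ≤ g i k)
    (hfac : ∀ (I : J.Interaction) j, I.factor j ≤ g I.road j) {C : ℝ} (hC : ∀ i j, g i j ≤ C) :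
    J.TangentBound C := fun n c => by
  have h : c.factor ≤ C := (c.factor_le hg hfac).trans (hC _ _)
  exact ⟨h, fun ξ hξ => (c.norm_out_le hξ).trans
    (mul_le_mul_of_nonneg_right h ((c.step 0).norm_in_nonneg _))⟩

end Junction

/-! ### Diverge junctions -/

/-- When the bound on link `i` of a diverge is set to `a`, the new flow on link `i` lies between the
old flow and `a`. -/
theorem IsDivergeFlux.mem_uIcc {α₁ α₂ : ℝ} (h₁ : 0 < α₁) (h₂ : 0 < α₂) {m m' q q' : Fin 3 → ℝ}
    (hq : IsDivergeFlux α₁ α₂ m q) (hq' : IsDivergeFlux α₁ α₂ m' q') {i : Fin 3}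
    (hm : ∀ j, j ≠ i → m' j = m j) (ha : m' i < q i ∨ (q i < m' i ∧ m i = q i)) :
    q' i ∈ Set.uIcc (q i) (m' i) := by
  obtain ⟨h0, h1, h2⟩ := hq
  obtain ⟨h0', h1', h2'⟩ := hq'
  -- Here `z` is the flow on link `0`, `w` the share of link `i` in it, and `R` the minimum of the
  -- other two bounds, rescaled to link `0`. The flow on link `i` is then its own bound cut off at
  -- `w * R`.
  have key : ∀ w : ℝ, 0 < w → ∀ R a b z z' : ℝ, z = min (b / w) R → z' = min (a / w) R →
      (a < w * z ∨ (w * z < a ∧ b = w * z)) → w * z' ∈ Set.uIcc (w * z) a := by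
    intro w hw R a b z z' hz hz' hab
    have e1 : w * z' = min a (w * R) := by
      rw [hz', mul_min_of_nonneg _ _ hw.le, mul_div_cancel₀ _ hw.ne']
    have e2 : w * z = min b (w * R) := by
      rw [hz, mul_min_of_nonneg _ _ hw.le, mul_div_cancel₀ _ hw.ne']
    have e3 : w * z ≤ w * R := e2 ▸ min_le_right _ _
    rw [e1, Set.mem_uIcc]
    rcases hab with h | ⟨h, -⟩
    · right; rw [min_eq_left (by linarith)]; exact ⟨le_rfl, h.le⟩
    · left; exact ⟨le_min h.le e3, min_le_left _ _⟩
  fin_cases i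
  · have := key 1 one_pos (min (m 1 / α₁) (m 2 / α₂)) (m' 0) (m 0) (q 0) (q' 0)
      (by simpa using h0) (by rw [h0', hm 1 (by decide), hm 2 (by decide)]; simp)
      (by simpa using ha)
    simpa using this
  · have := key α₁ h₁ (min (m 0) (m 2 / α₂)) (m' 1) (m 1) (q 0) (q' 0)
      (by rw [h0, min_left_comm])
      (by rw [h0', hm 0 (by decide), hm 2 (by decide), min_left_comm])
      (by rw [← h1]; exact ha)
    rw [← h1, ← h1'] at this
    exact this
  · have := key α₂ h₂ (min (m 0) (m 1 / α₁)) (m' 2) (m 2) (q 0) (q' 0)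
      (by rw [h0, ← min_assoc, min_comm])
      (by rw [h0', hm 0 (by decide), hm 1 (by decide), ← min_assoc, min_comm])
      (by rw [← h2]; exact ha)
    rw [← h2, ← h2'] at this
    exact this

theorem IsDivergeFlux.sub_eq {α₁ α₂ : ℝ} (h₁ : 0 < α₁) (h₂ : 0 < α₂) {m m' q q' : Fin 3 → ℝ}
    (hq : IsDivergeFlux α₁ α₂ m q) (hq' : IsDivergeFlux α₁ α₂ m' q') (i j : Fin 3) :
    q' j - q j = γ α₁ α₂ i j * (q' i - q i) := by
  obtain ⟨-, h1, h2⟩ := hq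
  obtain ⟨-, h1', h2'⟩ := hq'
  fin_cases i <;> fin_cases j <;> simp [γ, h1, h2, h1', h2'] <;> field_simp

theorem γ_pos {α₁ α₂ : ℝ} (h₁ : 0 < α₁) (h₂ : 0 < α₂) (i j : Fin 3) : 0 < γ α₁ α₂ i j := by
  fin_cases i <;> fin_cases j <;> simp [γ] <;> positivity

theorem γ_self (α₁ α₂ : ℝ) (i : Fin 3) : γ α₁ α₂ i i = 1 := by
  fin_cases i <;> simp [γ]

theorem γ_mul {α₁ α₂ : ℝ} (h₁ : 0 < α₁) (h₂ : 0 < α₂) (i j k : Fin 3) :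
    γ α₁ α₂ i j * γ α₁ α₂ j k = γ α₁ α₂ i k := by
  fin_cases i <;> fin_cases j <;> fin_cases k <;> simp [γ] <;> field_simp

open Junction

section Diverge

variable {α₁ α₂ : ℝ} {link : Fin 3 → FundamentalDiagram}

theorem isDivergeFlux_before (I : (diverge α₁ α₂ link).Interaction) :
    IsDivergeFlux α₁ α₂ ((diverge α₁ α₂ link).bound I.before)
      fun k => (link k).f (I.before k) :=
  I.rule_before

theorem isDivergeFlux_after (I : (diverge α₁ α₂ link).Interaction) :
    IsDivergeFlux α₁ α₂ ((diverge α₁ α₂ link).bound I.data) fun k => (link k).f (I.after k) :=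
  I.rule_after

theorem diverge_flux_mem_uIcc (h₁ : 0 < α₁) (h₂ : 0 < α₂) (I : (diverge α₁ α₂ link).Interaction) :
    (link I.road).f (I.after I.road) ∈
      Set.uIcc ((link I.road).f (I.before I.road)) ((link I.road).f I.arriving) := by
  have hb := I.bound_road
  have := IsDivergeFlux.mem_uIcc h₁ h₂ (isDivergeFlux_before I) (isDivergeFlux_after I)
    (fun j hj => I.bound_data_of_ne hj) (by rw [hb.1]; exact hb.2)
  rwa [hb.1] at this

theorem diverge_Δq_out (h₁ : 0 < α₁) (h₂ : 0 < α₂) (I : (diverge α₁ α₂ link).Interaction)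
    {j : Fin 3} (hj : j ≠ I.road) :
    I.Δq_out j = γ α₁ α₂ I.road j *
      ((link I.road).f (I.after I.road) - (link I.road).f (I.before I.road)) := by
  rw [Interaction.Δq_out, I.data_of_ne hj]
  exact IsDivergeFlux.sub_eq h₁ h₂ (isDivergeFlux_before I) (isDivergeFlux_after I) I.road j

/-- The flow on the arriving link covers part of the way to the arriving flux: this part, scaled by
`γ`, is transmitted, and the remainder is reflected. -/
theorem diverge_factor_le (h₁ : 0 < α₁) (h₂ : 0 < α₂) (I : (diverge α₁ α₂ link).Interaction)
    (j : Fin 3) : I.factor j ≤ γ α₁ α₂ I.road j := by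
  have hmem := diverge_flux_mem_uIcc h₁ h₂ I
  rw [Interaction.factor, div_le_iff₀ (abs_pos.2 I.Δq_in_ne_zero)]
  by_cases hj : j = I.road
  · rw [hj, γ_self, one_mul, Interaction.Δq_out, I.data_road, abs_sub_comm]
    exact Set.abs_sub_right_of_mem_uIcc hmem
  · rw [diverge_Δq_out h₁ h₂ I hj, abs_mul, abs_of_pos (γ_pos h₁ h₂ _ _)]
    exact mul_le_mul_of_nonneg_left (Set.abs_sub_left_of_mem_uIcc hmem) (γ_pos h₁ h₂ _ _).le

theorem diverge_factor_eq (h₁ : 0 < α₁) (h₂ : 0 < α₂) (I : (diverge α₁ α₂ link).Interaction)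
    {j : Fin 3} (hj : j ≠ I.road) (hI : I.NoReflection) : I.factor j = γ α₁ α₂ I.road j := by
  rw [Interaction.factor, div_eq_iff (abs_pos.2 I.Δq_in_ne_zero).ne', diverge_Δq_out h₁ h₂ I hj,
    abs_mul, abs_of_pos (γ_pos h₁ h₂ _ _), hI]
  rfl

end Diverge

/-! ### Merge junctions -/

section Merge

variable {p : ℝ} {m m' q q' : Fin 3 → ℝ}

/-- The merge flow exhausts both demands if it is below the supply; if it favours one of the
incoming links over the right-of-way line, then the demand of the other one is exhausted. -/
theorem IsMergeFlux.saturation (hp : 0 < p) (hq : IsMergeFlux p m q) :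
    (q 0 + q 1 < m 2 → q 0 = m 0 ∧ q 1 = m 1) ∧
      (p * q 0 < q 1 → q 0 = m 0) ∧ (q 1 < p * q 0 → q 1 = m 1) := by
  obtain ⟨⟨hx, hxm, hy, hym, hs⟩, -, hmax, hclose⟩ := hq
  refine ⟨fun h => ⟨?_, ?_⟩, fun h => ?_, fun h => ?_⟩
  · by_contra hne
    have hlt := lt_of_le_of_ne hxm hne
    -- Competitor: raise the first flow as far as its demand and the supply allow.
    have := hmax (min (m 0) (m 2 - q 1)) (q 1) ⟨le_min (by linarith) (by linarith),
      min_le_left _ _, hy, hym, by linarith [min_le_right (m 0) (m 2 - q 1)]⟩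
    have : q 0 < min (m 0) (m 2 - q 1) := lt_min hlt (by linarith)
    linarith
  · by_contra hne
    have hlt := lt_of_le_of_ne hym hne
    have := hmax (q 0) (min (m 1) (m 2 - q 0)) ⟨hx, hxm, le_min (by linarith) (by linarith),
      min_le_left _ _, by linarith [min_le_right (m 1) (m 2 - q 0)]⟩
    have : q 1 < min (m 1) (m 2 - q 0) := lt_min hlt (by linarith)
    linarith
  · by_contra hne
    have hlt := lt_of_le_of_ne hxm hne
    -- Moving `t` from link `1` to link `0` keeps the total and changes `p * x - y` by `(1 + p) *
    -- t`. The bound on `t` stops short of the line, so the distance strictly decreases.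
    obtain ⟨t, ht0, ht⟩ := exists_between
      (show 0 < min (m 0 - q 0) ((q 1 - p * q 0) / (1 + p)) from
        lt_min (by linarith) (div_pos (by linarith) (by linarith)))
    have ht1 := ht.trans_le (min_le_left _ _)
    have ht2 := (lt_div_iff₀ (by linarith)).1 (ht.trans_le (min_le_right _ _))
    have hpt : 0 < p * t := mul_pos hp ht0
    have hpx : 0 ≤ p * q 0 := mul_nonneg hp.le hx
    have h3 := hclose (q 0 + t) (q 1 - t)
      ⟨by linarith, by linarith, by linarith, by linarith, by linarith⟩ (by ring)
    rw [abs_of_neg (by linarith), abs_of_neg (by linarith)] at h3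
    linarith
  · by_contra hne
    have hlt := lt_of_le_of_ne hym hne
    have hx0 : 0 < q 0 := by
      by_contra hc
      have : p * q 0 ≤ 0 := mul_nonpos_of_nonneg_of_nonpos hp.le (not_lt.1 hc)
      linarith
    -- The same move in the opposite direction; `t < q 0` keeps the first flow nonnegative.
    obtain ⟨t, ht0, ht⟩ := exists_between
      (show 0 < min (min (m 1 - q 1) (q 0)) ((p * q 0 - q 1) / (1 + p)) from
        lt_min (lt_min (by linarith) hx0) (div_pos (by linarith) (by linarith)))
    have ht1 := ht.trans_le ((min_le_left _ _).trans (min_le_left _ _))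
    have ht3 := ht.trans_le ((min_le_left _ _).trans (min_le_right _ _))
    have ht2 := (lt_div_iff₀ (by linarith)).1 (ht.trans_le (min_le_right _ _))
    have hpt : 0 < p * t := mul_pos hp ht0
    have h3 := hclose (q 0 - t) (q 1 + t)
      ⟨by linarith, by linarith, by linarith, by linarith, by linarith⟩ (by ring)
    rw [abs_of_pos (by linarith), abs_of_pos (by linarith)] at h3
    linarith

/-- When the bound on link `i` of a merge is set to `m' i`, the reflected wave and the changes of
the flows on the other links are at most as large as the arriving wave. -/
theorem IsMergeFlux.abs_sub_le (hp : 0 < p) (hq : IsMergeFlux p m q)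
    (hq' : IsMergeFlux p m' q') {i : Fin 3} (hm : ∀ j, j ≠ i → m' j = m j)
    (ha : m' i < q i ∨ (q i < m' i ∧ m i = q i)) :
    |q' i - m' i| ≤ |m' i - q i| ∧ ∀ j, |q' j - q j| ≤ |m' i - q i| := by
  obtain ⟨hA, hB, hC⟩ := hq.saturation hp
  obtain ⟨hA', hB', hC'⟩ := hq'.saturation hp
  obtain ⟨⟨-, hxm, -, hym, hs⟩, h2, -⟩ := hq
  obtain ⟨⟨-, hxm', -, hym', hs'⟩, h2', -⟩ := hq'
  -- Monotonicity is all that is needed of the products with `p`; with them as atoms, the rest is a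
  -- linear case analysis on the saturation conditions.
  have hmono : q 0 ≤ q' 0 → p * q 0 ≤ p * q' 0 := fun h => mul_le_mul_of_nonneg_left h hp.le
  have hmono' : q' 0 ≤ q 0 → p * q' 0 ≤ p * q 0 := fun h => mul_le_mul_of_nonneg_left h hp.le
  generalize p * q 0 = u at *
  generalize p * q' 0 = u' at *
  have hj : ∀ P : Fin 3 → Prop, P 0 → P 1 → P 2 → ∀ j, P j := fun P h0 h1 h2 j => by
    fin_cases j <;> assumption
  fin_cases i
  · have e1 := hm 1 (by decide)
    have e2 := hm 2 (by decide)
    clear hm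
    refine ⟨?_, hj _ ?_ ?_ ?_⟩ <;> simp only [Fin.zero_eta] at * <;> grind
  · have e1 := hm 0 (by decide)
    have e2 := hm 2 (by decide)
    clear hm
    refine ⟨?_, hj _ ?_ ?_ ?_⟩ <;> simp only [Fin.mk_one] at * <;> grind
  · have e1 := hm 0 (by decide)
    have e2 := hm 1 (by decide)
    clear hm
    refine ⟨?_, hj _ ?_ ?_ ?_⟩ <;> simp only [Fin.reduceFinMk] at * <;> grind

theorem isMergeFlux_before {link : Fin 3 → FundamentalDiagram} (I : (merge p link).Interaction) :
    IsMergeFlux p ((merge p link).bound I.before) fun k => (link k).f (I.before k) :=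
  I.rule_before

theorem isMergeFlux_after {link : Fin 3 → FundamentalDiagram} (I : (merge p link).Interaction) :
    IsMergeFlux p ((merge p link).bound I.data) fun k => (link k).f (I.after k) :=
  I.rule_after

theorem merge_factor_le {link : Fin 3 → FundamentalDiagram} (hp : 0 < p)
    (I : (merge p link).Interaction) (j : Fin 3) : I.factor j ≤ 1 := by
  have hb := I.bound_road
  obtain ⟨hr, ht⟩ := IsMergeFlux.abs_sub_le hp (isMergeFlux_before I) (isMergeFlux_after I)
    (fun j hj => I.bound_data_of_ne hj) (by rw [hb.1]; exact hb.2)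
  rw [hb.1] at hr ht
  rw [Interaction.factor, div_le_iff₀ (abs_pos.2 I.Δq_in_ne_zero), one_mul, Interaction.Δq_out]
  by_cases hj : j = I.road
  · rw [hj, I.data_road]
    exact hr
  · rw [I.data_of_ne hj]
    exact ht j

end Merge

end TrafficJunction

open TrafficJunction in
theorem mainTheorem2 :
    -- diverge junctions
    (∀ α₁ α₂ : ℝ, 0 < α₁ → 0 < α₂ → α₁ + α₂ = 1 →
      (∀ i j k, γ α₁ α₂ i j * γ α₁ α₂ j k = γ α₁ α₂ i k) ∧
      (∀ link : Fin 3 → FundamentalDiagram,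
        (diverge α₁ α₂ link).ShiftFormula ∧
        ∀ (I : (diverge α₁ α₂ link).Interaction) (j : Fin 3), j ≠ I.road →
          I.factor j ≤ γ α₁ α₂ I.road j ∧
          (I.NoReflection → I.factor j = γ α₁ α₂ I.road j)) ∧
      ∃ C : ℝ, ∀ link : Fin 3 → FundamentalDiagram, (diverge α₁ α₂ link).TangentBound C) ∧
    -- merge junctions
    (∀ p : ℝ, 0 < p → p < 1 →
      (∀ link : Fin 3 → FundamentalDiagram, (merge p link).ShiftFormula) ∧
      ∃ C : ℝ, ∀ link : Fin 3 → FundamentalDiagram, (merge p link).TangentBound C) := by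
  refine ⟨fun α₁ α₂ h₁ h₂ _ => ⟨γ_mul h₁ h₂, fun link => ⟨Junction.shiftFormula _, fun I j hj =>
    ⟨diverge_factor_le h₁ h₂ I j, diverge_factor_eq h₁ h₂ I hj⟩⟩, ∑ i, ∑ j, γ α₁ α₂ i j,
    fun link => ?_⟩, fun p hp _ => ⟨fun link => Junction.shiftFormula _, 1, fun link => ?_⟩⟩
  · refine Junction.tangentBound_of_factor_le (fun i j k => (γ_mul h₁ h₂ i j k).le)
      (diverge_factor_le h₁ h₂) fun i j => ?_
    -- By nonnegativity the sum of all entries, chosen as `C`, dominates each of them.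
    have hpos : ∀ i j, 0 ≤ γ α₁ α₂ i j := fun i j => (γ_pos h₁ h₂ i j).le
    exact (Finset.single_le_sum (fun j _ => hpos i j) (Finset.mem_univ j)).trans
      (Finset.single_le_sum (f := fun i => ∑ j, γ α₁ α₂ i j)
        (fun i _ => Finset.sum_nonneg fun j _ => hpos i j) (Finset.mem_univ i))
  · exact Junction.tangentBound_of_factor_le (g := fun _ _ => 1) (by simp)
      (merge_factor_le hp) (by simp)
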